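/- **Setting.** Let $V$ be a set of $n\ge 1$ nodes. For a simple graph $G$ on $V$ let $d_u$ be the degree of $u$, $\mathrm{vol}(S)=\sum_{u\in S}d_u$, $\mathrm{vol}(G)=\mathrm{vol}(V)$, and let $E(S,\overline S)$ be the set of edges between $S\subseteq V$ and its complement. The conductance of $G$ is $$\Phi(G)=\min_{\emptyset\ne S\subsetneq V}\frac{|E(S,\overline S)|}{\min\{\mathrm{vol}(S),\mathrm{vol}(\overline S)\}}$$ (a quotient $0/0$ counts as $0$, so $\Phi(G)=0$ if $G$ is not connected). If $G$ is connected, its diligence is $$\rho(G)=\min_{\substack{S\subsetneq V\\ 0<\mathrm{vol}(S)\le \mathrm{vol}(G)/2}}\ \min_{\{u,v\}\in E(S,\overline S)}\max\Big\{\frac{\bar d(S)}{d_u},\frac{\bar d(S)}{d_v}\Big\},\qquad \bar d(S)=\frac{\mathrm{vol}(S)}{|S|},$$ and $\rho(G)=0$ if $G$ is not connected. (For $n=1$ there is no admissible $S$ and both parameters are set to $0$.) A dynamic evolving network is a sequence $\mathcal G=\{G^{(t)}\}_{t=0}^\infty$ of arbitrary simple graphs on $V$. The graph $G^{(t)}$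 is exposed at time $t$ and is in force during $[t,t+1)$; it may be fixed in advance or may depend, in a measurable way, on what the algorithm has done up to time $t$, but not on the future. In the asynchronous push-pull algorithm every node has its own independent Poisson clock of rate $1$ (independent exponential waiting times with rate $1$). Whenever the clock of $v$ ticks, at time $\tau$ say, $v$ contacts an independent uniformly random neighbour in $G^{(\lfloor\tau\rfloor)}$ (nobody, if it has no neighbour); if one of the two nodes knows the rumor, then both know it from then on. At time $0$ exactly one node knows the rumor. **Theorem.** Let $\mathcal G$ be an $n$-node dynamic evolving network with one node informed at time $0$, and let $c>1$. Put $c_0=\frac12-\frac1{\mathrm e}$, $C=(10c+20)/c_0$ and $$T(\mathcal G,c)=\min\Big\{t\in\{0,1,2,\dots\}:\ \sum_{p=0}^{t}\Phi(G^{(p)})\,\rho(G^{(p)})\ge C\log n\Big\},$$ with $T(\mathcal G,c)=\infty$ if there is no such $t$ (if the graphs depend on the run of the algorithm, then $T(\mathcal G,c)$ is random). Then, with probability at least $1-n^{-c}$, either $T(\mathcal G,c)=\infty$ or all nodes are informed at time $T(\mathcal G,c)$. -/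

import Mathlib

open MeasureTheory ProbabilityTheory

/-! ### Graph parameters -/

open Classical in
/-- The volume of a set of nodes: the sum of the degrees of its members. -/
noncomputable def vol {n : ℕ} (G : SimpleGraph (Fin n)) (S : Finset (Fin n)) : ℕ :=
  ∑ u ∈ S, G.degree u

open Classical in
/-- The number of edges between `S` and its complement. -/
noncomputable def cutSize {n : ℕ} (G : SimpleGraph (Fin n)) (S : Finset (Fin n)) : ℕ :=
  (G.interedges S Sᶜ).card

/-- The conductance of `G`: the minimum of `|E(S, Sᶜ)| / min (vol S) (vol Sᶜ)` over the nonempty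
proper subsets `S` of the node set. It is `0` if `G` is not connected. -/
noncomputable def conductance {n : ℕ} (G : SimpleGraph (Fin n)) : ℝ :=
  sInf {x : ℝ | ∃ S : Finset (Fin n), S.Nonempty ∧ S ⊂ Finset.univ ∧
    x = (cutSize G S : ℝ) / (min (vol G S) (vol G Sᶜ) : ℕ)}

/-- The average degree of the nodes in `S`. -/
noncomputable def avgDegree {n : ℕ} (G : SimpleGraph (Fin n)) (S : Finset (Fin n)) : ℝ :=
  (vol G S : ℝ) / S.card

open Classical in
/-- The diligence of the cut `E(S, Sᶜ)`. -/
noncomputable def cutDiligence {n : ℕ} (G : SimpleGraph (Fin n)) (S : Finset (Fin n)) : ℝ :=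
  sInf {x : ℝ | ∃ u ∈ S, ∃ v ∉ S, G.Adj u v ∧
    x = max (avgDegree G S / G.degree u) (avgDegree G S / G.degree v)}

open Classical in
/-- The diligence of a graph: the minimum of the diligence of the cuts `E(S, Sᶜ)` with
`0 < vol S ≤ vol G / 2` if the graph is connected, and `0` otherwise. -/
noncomputable def diligence {n : ℕ} (G : SimpleGraph (Fin n)) : ℝ :=
  if G.Connected then
    sInf {x : ℝ | ∃ S : Finset (Fin n), S ⊂ Finset.univ ∧ 0 < vol G S ∧
      2 * vol G S ≤ vol G Finset.univ ∧ x = cutDiligence G S}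
  else 0

/-! ### The randomness of the algorithm -/

/-- An outcome gives, for each node `v` and each `k`, the waiting time of the clock of `v` before
its tick number `k` (counted from `0`), and the node that `v` picks at this tick out of each set
of nodes that may turn out to be its set of neighbours at that moment. -/
abbrev Outcome (n : ℕ) : Type := Fin n × ℕ → ℝ × (Finset (Fin n) → Fin n)

open Classical in
/-- The law of a random member of `A`: uniform on `A`. If `A` is empty, the value is the
irrelevant default `v`. -/
noncomputable def pickLaw {n : ℕ} (v : Fin n) (A : Finset (Fin n)) : Measure (Fin n) :=
  if h : A.Nonempty then (PMF.uniformOfFinset A h).toMeasure else Measure.dirac v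

instance pickLaw_isProbabilityMeasure {n : ℕ} (v : Fin n) (A : Finset (Fin n)) :
    IsProbabilityMeasure (pickLaw v A) := by
  unfold pickLaw
  split_ifs <;> infer_instance

instance expMeasure_one_isProbabilityMeasure : IsProbabilityMeasure (expMeasure 1) :=
  isProbabilityMeasure_expMeasure one_pos

/-- The law of the outcome: all waiting times are exponential with rate `1`, all picks are uniform,
and everything is independent. -/
noncomputable def outcomeLaw (n : ℕ) : Measure (Outcome n) :=
  Measure.infinitePi fun i : Fin n × ℕ =>
    (expMeasure 1).prod (Measure.pi fun A : Finset (Fin n) => pickLaw i.1 A)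

/-- The time of tick number `k` (counted from `0`) of the clock of `v`. -/
noncomputable def tickTime {n : ℕ} (ω : Outcome n) (v : Fin n) (k : ℕ) : ℝ :=
  ∑ j ∈ Finset.range (k + 1), (ω (v, j)).1

/-! ### Dynamic evolving networks -/

/-- Two outcomes show the same ticks and the same picks during `[0, t]`. -/
def AgreeUpTo {n : ℕ} (t : ℝ) (ω ω' : Outcome n) : Prop :=
  ∀ v k, tickTime ω v k ≤ t ∨ tickTime ω' v k ≤ t →
    tickTime ω v k = tickTime ω' v k ∧ (ω (v, k)).2 = (ω' (v, k)).2

/-- A dynamic evolving network: a sequence of graphs on the same `n` nodes, the graph `G t` being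
exposed at time `t`. It is arbitrary, except that it does not foresee the future: it may depend
(measurably) on what has happened up to time `t`. Every fixed sequence of graphs is included. -/
structure IsDynamicNetwork {n : ℕ} (G : ℕ → Outcome n → SimpleGraph (Fin n)) : Prop where
  measurableSet_eq : ∀ (t : ℕ) (H : SimpleGraph (Fin n)), MeasurableSet {ω | G t ω = H}
  nonanticipating : ∀ (t : ℕ) (ω ω' : Outcome n), AgreeUpTo (t : ℝ) ω ω' → G t ω = G t ω'

/-! ### The asynchronous push-pull algorithm -/

open Classical in
/-- At time `τ` the clock of `v` ticks and `v` contacts `u`, picked at random among the neighbours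
of `v` in the current graph `G ⌊τ⌋₊`. (A node without neighbours contacts nobody.) -/
def Calls {n : ℕ} (G : ℕ → SimpleGraph (Fin n)) (ω : Outcome n) (τ : ℝ) (v u : Fin n) : Prop :=
  ∃ k, tickTime ω v k = τ ∧ (G ⌊τ⌋₊).Adj v u ∧ (ω (v, k)).2 ((G ⌊τ⌋₊).neighborFinset v) = u

/-- `Informed G v₀ ω τ v`: node `v` knows the rumor at time `τ`, if `v₀` knows it at time `0`.
If one of two nodes knows the rumor when either of them contacts the other, then both know it from
then on. -/
inductive Informed {n : ℕ} (G : ℕ → SimpleGraph (Fin n)) (v₀ : Fin n) (ω : Outcome n) :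
    ℝ → Fin n → Prop
  | source {τ : ℝ} : 0 ≤ τ → Informed G v₀ ω τ v₀
  | contact {σ τ : ℝ} {u v : Fin n} : Informed G v₀ ω σ u → Calls G ω σ u v ∨ Calls G ω σ v u →
      σ ≤ τ → Informed G v₀ ω τ v

/-!
The rumor spreads across the cut between the set `S` of informed nodes and its complement with rate
`∑ (1 / d u + 1 / d v)`, the sum being over the edges `{u, v}` of the cut. By the definition of the
diligence, applied to the side of the cut with the smaller volume, each edge contributes at least
the diligence divided by the average degree of that side, and the conductance bounds the number of
edges from below. So the rate is at least `conductance * diligence * min |S| (n - |S|)`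
(`min_card_mul_le_crossRate`).

Time is divided into periods of length `1 / n`, and of the contacts in each period only those with
nodes informed before the period are counted. Since the exponential distribution is memoryless, the
probability of no contact across the cut during a period, given the past, is at most
`exp (-(1 - exp (-1 / n)) * rate)`, however the graphs depend on the past (`measure_inter_noTick_le`).
It follows that `potential n |S| = n / |S| - 1`, multiplied by the exponential of `1 / 8` of the sum
of conductance times diligence up to now (integrated over time), is a supermartingale
(`setLIntegral_weightedPotential_succ_le`). It starts at `n - 1`. If some node is uninformed when the
sum has reached `C log n - 3`, its value is at least `exp ((C log n - 3) / 8) / (n - 1)`, which by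
the maximal inequality for nonnegative supermartingales (`measure_exists_le_le`) has probability at
most `n ^ (-c)`. The maximal inequality also takes care of the random time `T`. The term `3` makes up
for the graph exposed at time `T`, which counts in the sum but has not been in force by then.
-/

/-! ### Waiting times and the law of the outcome -/

lemma expMeasure_one_Ioi {u : ℝ} (hu : 0 ≤ u) :
    (expMeasure 1).real (Set.Ioi u) = Real.exp (-u) := by
  rw [← Set.compl_Iic, probReal_compl_eq_one_sub measurableSet_Iic, ← cdf_eq_real,
    cdf_expMeasure_eq one_pos, if_pos hu]
  simp

lemma expMeasure_one_Ioo {u δ : ℝ} (hu : 0 ≤ u) (hδ : 0 ≤ δ) :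
    (expMeasure 1).real (Set.Ioo u (u + δ)) = Real.exp (-u) * (1 - Real.exp (-δ)) := by
  have : NullSingletonClass (expMeasure 1) := by
    unfold expMeasure gammaMeasure
    infer_instance
  have h : Set.Ioc u (u + δ) = Set.Ioi u \ Set.Ioi (u + δ) := by ext; simp
  rw [measureReal_congr Ioo_ae_eq_Ioc, h, measureReal_sdiff (Set.Ioi_subset_Ioi (by linarith))
    measurableSet_Ioi, expMeasure_one_Ioi hu, expMeasure_one_Ioi (by linarith), neg_add,
    Real.exp_add]
  ring

/-- Memorylessness of the waiting time of a clock, for a tick together with its pick: after a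
waiting time `u`, the chance that a tick within the next `δ` has a pick in `B` is
`(1 - exp (-δ)) * ν B`. -/
lemma expMeasure_prod_avoid {X : Type*} [MeasurableSpace X] (ν : Measure X)
    [IsProbabilityMeasure ν] {B : Set X} (hB : MeasurableSet B) {u δ : ℝ} (hu : 0 ≤ u)
    (hδ : 0 ≤ δ) :
    ((expMeasure 1).prod ν) {y | u < y.1 ∧ (y.1 < u + δ → y.2 ∉ B)} =
      ENNReal.ofReal (1 - (1 - Real.exp (-δ)) * ν.real B) *
        ((expMeasure 1).prod ν) {y | u < y.1} := by
  have h1 : {y : ℝ × X | u < y.1} = Set.Ioi u ×ˢ Set.univ := by ext; simp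
  have h2 : {y : ℝ × X | u < y.1 ∧ (y.1 < u + δ → y.2 ∉ B)} =
      (Set.Ioi u ×ˢ Set.univ) \ (Set.Ioo u (u + δ) ×ˢ B) := by
    ext; simp; tauto
  have h3 : Set.Ioo u (u + δ) ×ˢ B ⊆ Set.Ioi u ×ˢ Set.univ :=
    Set.prod_mono Set.Ioo_subset_Ioi_self (Set.subset_univ _)
  have e1 : 0 ≤ 1 - Real.exp (-δ) := by simpa using hδ
  have e2 : (1 - Real.exp (-δ)) * ν.real B ≤ 1 :=
    mul_le_one₀ (by linarith [Real.exp_pos (-δ)]) measureReal_nonneg measureReal_le_one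
  rw [h2, h1, ← ofReal_measureReal, ← ofReal_measureReal (s := Set.Ioi u ×ˢ Set.univ),
    ← ENNReal.ofReal_mul (by linarith), measureReal_sdiff h3 (measurableSet_Ioo.prod hB),
    measureReal_prod_prod, measureReal_prod_prod, expMeasure_one_Ioi hu, expMeasure_one_Ioo hu hδ,
    probReal_univ]
  congr 1
  ring

/-- Replace the waiting time and pick of each `v` at index `m v` by `y v`. -/
def resample {n : ℕ} (m : Fin n → ℕ) (p : Outcome n × (Fin n → ℝ × (Finset (Fin n) → Fin n))) :
    Outcome n :=
  fun i => if i.2 = m i.1 then p.2 i.1 else p.1 i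

/-- The law of a waiting time together with the picks at its end. -/
noncomputable abbrev tickLaw {n : ℕ} (v : Fin n) : Measure (ℝ × (Finset (Fin n) → Fin n)) :=
  (expMeasure 1).prod (Measure.pi fun A : Finset (Fin n) => pickLaw v A)

instance outcomeLaw_isProbabilityMeasure (n : ℕ) : IsProbabilityMeasure (outcomeLaw n) := by
  unfold outcomeLaw; infer_instance

lemma measurable_resample {n : ℕ} (m : Fin n → ℕ) : Measurable (resample m) := by
  refine measurable_pi_lambda _ fun i => ?_
  unfold resample
  split_ifs <;> fun_prop

lemma map_resample {n : ℕ} (m : Fin n → ℕ) :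
    ((outcomeLaw n).prod (Measure.pi tickLaw)).map (resample m) = outcomeLaw n := by
  classical
  refine Measure.eq_infinitePi _ fun s t ht => ?_
  have hs : MeasurableSet (Set.pi (s : Set (Fin n × ℕ)) t) :=
    MeasurableSet.pi s.countable_toSet fun i _ => ht i
  have hpre : resample m ⁻¹' (Set.pi s t) =
      (Set.pi (s.filter fun i => i.2 ≠ m i.1 : Finset _) t) ×ˢ
      (Set.pi Set.univ fun v => if (v, m v) ∈ s then t (v, m v) else Set.univ) := by
    ext ⟨ω, y⟩
    simp only [resample, Set.mem_preimage, Set.mem_pi, Finset.mem_coe, Set.mem_prod,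
      Finset.mem_filter, Set.mem_univ, forall_const]
    constructor
    · intro h
      refine ⟨fun i hi => by simpa [hi.2] using h i hi.1, fun v => ?_⟩
      split_ifs with hv
      · simpa using h _ hv
      · trivial
    · rintro ⟨h1, h2⟩ ⟨v, k⟩ hi
      by_cases hk : k = m v
      · subst hk
        simpa [hi] using h2 v
      · simpa [hk] using h1 (v, k) ⟨hi, hk⟩
  rw [Measure.map_apply (measurable_resample m) hs, hpre, Measure.prod_prod, Measure.pi_pi,
    outcomeLaw, Measure.infinitePi_pi _ fun i _ => ht i,
    ← Finset.prod_filter_mul_prod_filter_not s (fun i => i.2 ≠ m i.1)]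
  congr 1
  have : (s.filter fun i => ¬ i.2 ≠ m i.1) =
      (Finset.univ.filter fun v => (v, m v) ∈ s).image fun v => (v, m v) := by
    ext ⟨v, k⟩
    simp only [Finset.mem_filter, Finset.mem_image, Finset.mem_univ, true_and, Prod.mk.injEq]
    constructor
    · rintro ⟨h, h'⟩
      have : k = m v := by simpa using h'
      subst this
      exact ⟨v, h, rfl, rfl⟩
    · rintro ⟨w, h, rfl, rfl⟩
      exact ⟨h, by simp⟩
  rw [this, Finset.prod_image (by intro a _ b _ h; exact (Prod.mk.inj h).1), Finset.prod_filter]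
  refine Finset.prod_congr rfl fun v _ => ?_
  split_ifs <;> simp

lemma outcomeLaw_eval {n : ℕ} (i : Fin n × ℕ) {s : Set ℝ} (hs : MeasurableSet s) :
    outcomeLaw n {ω | (ω i).1 ∈ s} = expMeasure 1 s := by
  have h : {ω : Outcome n | (ω i).1 ∈ s} = Set.pi (({i} : Finset (Fin n × ℕ)) : Set _)
      (fun _ => s ×ˢ Set.univ) := by
    ext; simp
  rw [h, outcomeLaw, Measure.infinitePi_pi _ fun i _ => hs.prod MeasurableSet.univ]
  simp

lemma ae_waiting_pos (n : ℕ) : ∀ᵐ ω ∂outcomeLaw n, ∀ i, 0 < (ω i).1 := by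
  rw [ae_all_iff]
  intro i
  have h : outcomeLaw n {ω | (ω i).1 ∈ Set.Ioi 0} = 1 := by
    rw [outcomeLaw_eval i measurableSet_Ioi, ← ofReal_measureReal, expMeasure_one_Ioi le_rfl]
    simp
  exact (prob_compl_eq_zero_iff (by measurability)).2 h

lemma ae_exists_lt_waiting (n : ℕ) (v : Fin n) (s : ℝ) (hs : 0 ≤ s) :
    ∀ᵐ ω ∂outcomeLaw n, ∃ k, s < (ω (v, k)).1 := by
  have hlt : expMeasure 1 (Set.Iic s) < 1 := by
    rw [← ofReal_measureReal, ← ENNReal.ofReal_one, ← Set.compl_Ioi,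
      probReal_compl_eq_one_sub measurableSet_Ioi, expMeasure_one_Ioi hs]
    exact (ENNReal.ofReal_lt_ofReal_iff one_pos).2 (by linarith [Real.exp_pos (-s)])
  have key : ∀ K : ℕ, outcomeLaw n {ω | ¬ ∃ k, s < (ω (v, k)).1} ≤
      (expMeasure 1 (Set.Iic s)) ^ K := by
    intro K
    classical
    have hsub : {ω : Outcome n | ¬ ∃ k, s < (ω (v, k)).1} ⊆
        Set.pi (((Finset.range K).image fun k => (v, k) : Finset (Fin n × ℕ)) : Set _)
          (fun _ => Set.Iic s ×ˢ Set.univ) := by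
      intro ω hω
      simp only [not_exists, not_lt, Set.mem_ofPred_eq] at hω
      intro i hi
      obtain ⟨k, -, rfl⟩ := Finset.mem_image.1 (Finset.mem_coe.1 hi)
      simpa using hω k
    refine (measure_mono hsub).trans ?_
    rw [outcomeLaw, Measure.infinitePi_pi _ fun i _ => measurableSet_Iic.prod MeasurableSet.univ,
      Finset.prod_image (by intro a _ b _ h; exact (Prod.mk.inj h).2)]
    simp
  exact le_antisymm (ge_of_tendsto' (ENNReal.tendsto_pow_atTop_nhds_zero_of_lt_one hlt) key)
    zero_le

/-! ### Memorylessness -/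

lemma AgreeUpTo.symm {n : ℕ} {t : ℝ} {ω ω' : Outcome n} (h : AgreeUpTo t ω ω') :
    AgreeUpTo t ω' ω := fun v k hk =>
  ⟨(h v k hk.symm).1.symm, (h v k hk.symm).2.symm⟩

lemma AgreeUpTo.mono {n : ℕ} {s t : ℝ} {ω ω' : Outcome n} (h : AgreeUpTo t ω ω') (hst : s ≤ t) :
    AgreeUpTo s ω ω' := fun v k hk => h v k (hk.imp hst.trans' hst.trans')

/-- The σ-algebra of the events that are decided by the ticks and picks during `[0, s]`: the
measurable events that do not separate outcomes which agree up to time `s`. -/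
@[reducible] def past (n : ℕ) (s : ℝ) : MeasurableSpace (Outcome n) where
  MeasurableSet' A := MeasurableSet A ∧ ∀ ω ω', AgreeUpTo s ω ω' → ω ∈ A → ω' ∈ A
  measurableSet_empty := ⟨MeasurableSet.empty, fun _ _ _ h => h⟩
  measurableSet_compl A hA :=
    ⟨hA.1.compl, fun ω ω' h hω hω' => hω (hA.2 ω' ω h.symm hω')⟩
  measurableSet_iUnion f hf := by
    refine ⟨MeasurableSet.iUnion fun i => (hf i).1, fun ω ω' h hω => ?_⟩
    obtain ⟨i, hi⟩ := Set.mem_iUnion.1 hω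
    exact Set.mem_iUnion.2 ⟨i, (hf i).2 ω ω' h hi⟩

lemma past_le (n : ℕ) (s : ℝ) : past n s ≤ MeasurableSpace.pi := fun _ h => h.1

lemma past_mono (n : ℕ) : Monotone (past n) := fun _ _ hst _ h =>
  ⟨h.1, fun ω ω' h' => h.2 ω ω' (h'.mono hst)⟩

lemma measurable_tickTime {n : ℕ} (v : Fin n) (k : ℕ) :
    Measurable fun ω : Outcome n => tickTime ω v k := by
  unfold tickTime
  fun_prop

section Resample

variable {n : ℕ} {m : Fin n → ℕ} {ω : Outcome n} {y : Fin n → ℝ × (Finset (Fin n) → Fin n)}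

lemma resample_of_ne {v : Fin n} {k : ℕ} (hk : k ≠ m v) : resample m (ω, y) (v, k) = ω (v, k) :=
  if_neg hk

lemma resample_self (v : Fin n) : resample m (ω, y) (v, m v) = y v := if_pos rfl

lemma tickTime_resample_of_lt {v : Fin n} {k : ℕ} (hk : k < m v) :
    tickTime (resample m (ω, y)) v k = tickTime ω v k := by
  refine Finset.sum_congr rfl fun j hj => ?_
  rw [resample_of_ne (by have := Finset.mem_range.1 hj; omega)]

lemma tickTime_resample_self (v : Fin n) :
    tickTime (resample m (ω, y)) v (m v) = ∑ j ∈ Finset.range (m v), (ω (v, j)).1 + (y v).1 := by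
  rw [tickTime, Finset.sum_range_succ, resample_self]
  congr 1
  refine Finset.sum_congr rfl fun j hj => ?_
  rw [resample_of_ne (Finset.mem_range.1 hj).ne]

lemma lt_tickTime_resample (hω : ∀ i, 0 < (ω i).1) {s : ℝ} {v : Fin n}
    (hs : s < tickTime (resample m (ω, y)) v (m v)) {k : ℕ} (hk : m v ≤ k) :
    s < tickTime (resample m (ω, y)) v k := by
  induction k, hk using Nat.le_induction with
  | base => exact hs
  | succ k hk ih =>
    rw [tickTime, Finset.sum_range_succ, resample_of_ne (by omega)]
    exact ih.trans_le (le_add_of_nonneg_right (hω _).le)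

end Resample

/-- The event that `m v` ticks of each clock `v` happen up to time `s`. -/
def tickCountEvent {n : ℕ} (s : ℝ) (m : Fin n → ℕ) : Set (Outcome n) :=
  {ω | ∀ v, (∀ k < m v, tickTime ω v k ≤ s) ∧ s < tickTime ω v (m v)}

lemma measurableSet_tickCountEvent {n : ℕ} (s : ℝ) (m : Fin n → ℕ) :
    MeasurableSet (tickCountEvent s m) := by
  have h : tickCountEvent s m = ⋂ v, (⋂ k, ⋂ _ : k < m v, {ω | tickTime ω v k ≤ s}) ∩
      {ω | s < tickTime ω v (m v)} := by
    ext; simp [tickCountEvent]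
  rw [h]
  exact MeasurableSet.iInter fun v => (MeasurableSet.iInter fun k => MeasurableSet.iInter fun _ =>
    measurableSet_le (measurable_tickTime v k) measurable_const).inter
    (measurableSet_lt measurable_const (measurable_tickTime v _))

lemma pairwise_disjoint_tickCountEvent {n : ℕ} (s : ℝ) :
    Pairwise (Function.onFun Disjoint (tickCountEvent (n := n) s)) := by
  intro m m' hne
  refine Set.disjoint_left.2 fun ω h h' => hne (funext fun v => ?_)
  rcases lt_trichotomy (m v) (m' v) with hlt | heq | hlt
  · exact absurd ((h' v).1 _ hlt) (not_le.2 (h v).2)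
  · exact heq
  · exact absurd ((h v).1 _ hlt) (not_le.2 (h' v).2)

lemma ae_mem_iUnion_tickCountEvent (n : ℕ) {s : ℝ} (hs : 0 ≤ s) :
    ∀ᵐ ω ∂outcomeLaw n, ω ∈ ⋃ m, tickCountEvent s m := by
  filter_upwards [ae_waiting_pos n, ae_all_iff.2 fun v => ae_exists_lt_waiting n v s hs]
    with ω hpos hex
  have hex' : ∀ v, ∃ k, s < tickTime ω v k := fun v => by
    obtain ⟨k, hk⟩ := hex v
    exact ⟨k, hk.trans_le (Finset.single_le_sum (f := fun j => (ω (v, j)).1)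
      (fun j _ => (hpos _).le) (Finset.self_mem_range_succ k))⟩
  classical
  refine Set.mem_iUnion.2 ⟨fun v => Nat.find (hex' v), fun v => ⟨fun k hk => ?_, ?_⟩⟩
  · exact not_lt.1 (Nat.find_min (hex' v) hk)
  · exact Nat.find_spec (hex' v)

/-- The event that no clock `v` ticks during `(s, s + δ)` with a pick in `B v`. -/
def noTick {n : ℕ} (s δ : ℝ) (B : Fin n → Set (Finset (Fin n) → Fin n)) : Set (Outcome n) :=
  {ω | ∀ v k, s < tickTime ω v k → tickTime ω v k < s + δ → (ω (v, k)).2 ∉ B v}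

lemma measurableSet_noTick {n : ℕ} (s δ : ℝ) (B : Fin n → Set (Finset (Fin n) → Fin n)) :
    MeasurableSet (noTick s δ B) := by
  have h : noTick s δ B = ⋂ v, ⋂ k, ({ω | s < tickTime ω v k} ∩ {ω | tickTime ω v k < s + δ} ∩
      {ω | (ω (v, k)).2 ∈ B v})ᶜ := by
    ext; simp [noTick]
  rw [h]
  refine MeasurableSet.iInter fun v => MeasurableSet.iInter fun k => MeasurableSet.compl ?_
  refine ((measurableSet_lt measurable_const (measurable_tickTime v k)).inter
    (measurableSet_lt (measurable_tickTime v k) measurable_const)).inter ?_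
  exact (measurable_snd.comp (measurable_pi_apply (v, k))) (Set.toFinite (B v)).measurableSet

/-- The probability that, for every `v`, it is not the case that a fresh waiting time of `v` is
below `δ` and the pick at its end lies in `B v`. It bounds the probability of `noTick s δ B`. -/
noncomputable def noTickProb {n : ℕ} (δ : ℝ) (B : Fin n → Set (Finset (Fin n) → Fin n)) : ENNReal :=
  ∏ v, ENNReal.ofReal
    (1 - (1 - Real.exp (-δ)) * (Measure.pi fun A : Finset (Fin n) => pickLaw v A).real (B v))

/-- Given the past up to time `s` with `m v` ticks of each clock `v`, the remaining waiting times
are again exponential. The tick number `m v` of each `v` is resampled: whatever the other ticks,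
the event in question then confines the resampled ticks to a box. -/
lemma measure_inter_tickCountEvent_le {n : ℕ} {s δ : ℝ} (hδ : 0 ≤ δ) {A : Set (Outcome n)}
    (hA : MeasurableSet[past n s] A) (hs : 0 ≤ s) (B : Fin n → Set (Finset (Fin n) → Fin n))
    (m : Fin n → ℕ) :
    outcomeLaw n (A ∩ tickCountEvent s m ∩ noTick s δ B) ≤
      noTickProb δ B * outcomeLaw n (A ∩ tickCountEvent s m) := by
  have hE : MeasurableSet (A ∩ tickCountEvent s m) := hA.1.inter (measurableSet_tickCountEvent s m)
  have hE' := hE.inter (measurableSet_noTick s δ B)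
  rw [← map_resample m, Measure.map_apply (measurable_resample m) hE,
    Measure.map_apply (measurable_resample m) hE',
    Measure.prod_apply (measurable_resample m hE), Measure.prod_apply (measurable_resample m hE'),
    ← lintegral_const_mul _ (measurable_measure_prodMk_left (measurable_resample m hE))]
  refine lintegral_mono_ae ?_
  filter_upwards [ae_waiting_pos n] with ω hω
  rcases Set.eq_empty_or_nonempty (Prod.mk ω ⁻¹' (resample m ⁻¹' (A ∩ tickCountEvent s m)))
    with hemp | ⟨y₀, hy₀A, hy₀⟩
  · rw [Set.inter_comm _ (noTick s δ B), Set.preimage_inter, Set.preimage_inter, hemp,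
      Set.inter_empty, measure_empty]
    exact zero_le
  set u : Fin n → ℝ := fun v => s - ∑ j ∈ Finset.range (m v), (ω (v, j)).1 with hu
  have hu0 : ∀ v, 0 ≤ u v := by
    intro v
    rw [hu]
    rcases Nat.eq_zero_or_pos (m v) with h0 | hpos
    · simp [h0, hs]
    · have := (hy₀ v).1 (m v - 1) (by omega)
      rw [tickTime_resample_of_lt (by omega), tickTime, Nat.sub_add_cancel hpos] at this
      simpa using this
  -- The condition on the resampled ticks is a box, as the past cannot tell its points apart.
  have hbox : Set.pi Set.univ (fun v => {x : ℝ × (Finset (Fin n) → Fin n) | u v < x.1}) ⊆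
      Prod.mk ω ⁻¹' (resample m ⁻¹' (A ∩ tickCountEvent s m)) := by
    intro y hy
    have hlate : ∀ v, s < tickTime (resample m (ω, y)) v (m v) := fun v => by
      have : u v < (y v).1 := hy v trivial
      rw [tickTime_resample_self]
      linarith [hu]
    refine ⟨hA.2 _ _ ?_ hy₀A, fun v => ⟨fun k hk => ?_, hlate v⟩⟩
    · intro v k hk
      have hkm : k < m v := by
        by_contra hcon
        push Not at hcon
        rcases hk with h | h
        · exact absurd h (not_le.2 (lt_tickTime_resample hω (hy₀ v).2 hcon))
        · exact absurd h (not_le.2 (lt_tickTime_resample hω (hlate v) hcon))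
      rw [tickTime_resample_of_lt hkm, tickTime_resample_of_lt hkm, resample_of_ne hkm.ne,
        resample_of_ne hkm.ne]
      exact ⟨rfl, rfl⟩
    · rw [tickTime_resample_of_lt hk, ← tickTime_resample_of_lt (y := y₀) hk]
      exact (hy₀ v).1 k hk
  have hbox' : Prod.mk ω ⁻¹' (resample m ⁻¹' (A ∩ tickCountEvent s m ∩ noTick s δ B)) ⊆
      Set.pi Set.univ (fun v => {x | u v < x.1 ∧ (x.1 < u v + δ → x.2 ∉ B v)}) := by
    rintro y ⟨⟨-, hy⟩, hno⟩ v -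
    have h1 := (hy v).2
    have h2 := hno v (m v) h1
    rw [tickTime_resample_self] at h1 h2
    rw [resample_self] at h2
    exact ⟨by rw [hu]; linarith, fun h => h2 (by rw [hu] at h; linarith)⟩
  refine (measure_mono hbox').trans (le_trans ?_ (mul_le_mul_right (measure_mono hbox) _))
  rw [Measure.pi_pi, Measure.pi_pi, noTickProb, ← Finset.prod_mul_distrib]
  exact (Finset.prod_congr rfl fun v _ =>
    expMeasure_prod_avoid _ (Set.toFinite (B v)).measurableSet (hu0 v) hδ).le

/-- Given the past up to time `s`, the probability of `noTick s δ B` is at most `noTickProb δ B`. -/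
lemma measure_inter_noTick_le {n : ℕ} {s δ : ℝ} (hs : 0 ≤ s) (hδ : 0 ≤ δ) {A : Set (Outcome n)}
    (hA : MeasurableSet[past n s] A) (B : Fin n → Set (Finset (Fin n) → Fin n)) :
    outcomeLaw n (A ∩ noTick s δ B) ≤ noTickProb δ B * outcomeLaw n A := by
  have split : ∀ C : Set (Outcome n), MeasurableSet C →
      outcomeLaw n C = ∑' m, outcomeLaw n (C ∩ tickCountEvent s m) := by
    intro C hC
    rw [← measure_iUnion, ← Set.inter_iUnion]
    · refine measure_congr ?_
      filter_upwards [ae_mem_iUnion_tickCountEvent n hs] with ω hω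
      exact propext ⟨fun h => ⟨h, hω⟩, fun h => h.1⟩
    · exact fun m m' h => ((pairwise_disjoint_tickCountEvent s h).mono Set.inter_subset_right
        Set.inter_subset_right)
    · exact fun m => hC.inter (measurableSet_tickCountEvent s m)
  rw [split _ (hA.1.inter (measurableSet_noTick s δ B)), split _ hA.1, ← ENNReal.tsum_mul_left]
  refine ENNReal.tsum_le_tsum fun m => ?_
  rw [Set.inter_right_comm]
  exact measure_inter_tickCountEvent_le hδ hA hs B m

/-- The bound of `measure_inter_noTick_le` for weights that depend on the past. -/
lemma setLIntegral_noTick_le {n : ℕ} {s δ : ℝ} (hs : 0 ≤ s) (hδ : 0 ≤ δ)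
    {f : Outcome n → ENNReal} (hf : Measurable[past n s] f)
    (B : Fin n → Set (Finset (Fin n) → Fin n)) :
    ∫⁻ ω in noTick s δ B, f ω ∂outcomeLaw n ≤ noTickProb δ B * ∫⁻ ω, f ω ∂outcomeLaw n := by
  have hle : ((outcomeLaw n).restrict (noTick s δ B)).trim (past_le n s) ≤
      noTickProb δ B • (outcomeLaw n).trim (past_le n s) := by
    refine @Measure.le_iff _ (past n s) _ _ |>.2 fun A hA => ?_
    rw [Measure.smul_apply, trim_measurableSet_eq _ hA, trim_measurableSet_eq _ hA,
      Measure.restrict_apply hA.1]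
    exact measure_inter_noTick_le hs hδ hA B
  rw [← lintegral_trim (past_le n s) hf, ← lintegral_trim (past_le n s) hf,
    ← smul_eq_mul, ← lintegral_smul_measure]
  exact lintegral_mono' hle le_rfl

/-! ### The rate of contacts across a cut -/

/-- The picks with which `v` contacts, in the graph `H`, a node on the other side of the cut between
`S` and its complement, if `N v` is the set of its neighbours. -/
def crossPicks {n : ℕ} (H : SimpleGraph (Fin n)) (S : Finset (Fin n)) (N : Fin n → Finset (Fin n))
    (v : Fin n) : Set (Finset (Fin n) → Fin n) :=
  {π | H.Adj v (π (N v)) ∧ ¬(v ∈ S ↔ π (N v) ∈ S)}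

open Classical in
/-- The rate of the contacts across the cut between `S` and its complement. -/
noncomputable def crossRate {n : ℕ} (H : SimpleGraph (Fin n)) (S : Finset (Fin n)) : ℝ :=
  ∑ v, ((H.neighborFinset v).filter fun w => ¬(v ∈ S ↔ w ∈ S)).card / (H.degree v : ℝ)

open Classical in
lemma pickLaw_crossPicks {n : ℕ} (H : SimpleGraph (Fin n)) (S : Finset (Fin n)) (v : Fin n) :
    (Measure.pi fun A : Finset (Fin n) => pickLaw v A).real
        (crossPicks H S (fun v => H.neighborFinset v) v) =
      ((H.neighborFinset v).filter fun w => ¬(v ∈ S ↔ w ∈ S)).card / (H.degree v : ℝ) := by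
  have h : crossPicks H S (fun v => H.neighborFinset v) v =
      Function.eval (H.neighborFinset v) ⁻¹' {w : Fin n | H.Adj v w ∧ ¬(v ∈ S ↔ w ∈ S)} := rfl
  rw [h, measureReal_def, (measurePreserving_eval (fun A : Finset (Fin n) => pickLaw v A)
    (H.neighborFinset v)).measure_preimage (Set.toFinite _).measurableSet.nullMeasurableSet, pickLaw]
  split_ifs with hne
  · rw [PMF.toMeasure_uniformOfFinset_apply _ _ (Set.toFinite _).measurableSet]
    have (w : Fin n) : (w ∈ H.neighborFinset v ∧ w ∈ {w | H.Adj v w ∧ ¬(v ∈ S ↔ w ∈ S)}) ↔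
        (w ∈ H.neighborFinset v ∧ ¬(v ∈ S ↔ w ∈ S)) := by simp
    rw [ENNReal.toReal_div, ENNReal.toReal_natCast, ENNReal.toReal_natCast,
      SimpleGraph.card_neighborFinset_eq_degree]
    congr 3
    ext w
    simpa only [Finset.mem_filter] using this w
  · rw [Finset.not_nonempty_iff_eq_empty] at hne
    simp [hne]

lemma crossRate_le {n : ℕ} (H : SimpleGraph (Fin n)) (S : Finset (Fin n)) : crossRate H S ≤ n := by
  classical
  have : crossRate H S ≤ ∑ _v : Fin n, (1 : ℝ) := by
    refine Finset.sum_le_sum fun v _ => div_le_one_of_le₀ ?_ (Nat.cast_nonneg _)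
    rw [← SimpleGraph.card_neighborFinset_eq_degree]
    exact_mod_cast Finset.card_filter_le _ _
  simpa using this

open Classical in
lemma crossRate_eq_sum_interedges {n : ℕ} (H : SimpleGraph (Fin n)) (S : Finset (Fin n)) :
    crossRate H S =
      ∑ e ∈ H.interedges S Sᶜ, ((1 : ℝ) / H.degree e.1 + 1 / H.degree e.2) := by
  have h1 : ∀ v, ((((H.neighborFinset v).filter fun w => ¬(v ∈ S ↔ w ∈ S)).card : ℝ) /
      (H.degree v : ℝ)) = ∑ w, ((if v ∈ S ∧ w ∉ S ∧ H.Adj v w then (1 : ℝ) / H.degree v else 0) +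
        if w ∈ S ∧ v ∉ S ∧ H.Adj w v then (1 : ℝ) / H.degree v else 0) := by
    intro v
    rw [Finset.card_filter, Nat.cast_sum, Finset.sum_div, SimpleGraph.neighborFinset_eq_filter,
      Finset.sum_filter]
    refine Finset.sum_congr rfl fun w _ => ?_
    by_cases hv : v ∈ S <;> by_cases hw : w ∈ S <;> simp [hv, hw, H.adj_comm w v]
  have h2 : H.interedges S Sᶜ = (Finset.univ ×ˢ Finset.univ).filter
      fun e => e.1 ∈ S ∧ e.2 ∉ S ∧ H.Adj e.1 e.2 := by
    ext ⟨a, b⟩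
    simp [SimpleGraph.interedges, Rel.mem_interedges_iff]
  rw [crossRate, Finset.sum_congr rfl fun v _ => h1 v, h2, Finset.sum_filter,
    Finset.sum_product]
  simp_rw [Finset.sum_add_distrib]
  rw [Finset.sum_comm (f := fun v w => if w ∈ S ∧ v ∉ S ∧ H.Adj w v then (1 : ℝ) / H.degree v else 0),
    ← Finset.sum_add_distrib]
  refine Finset.sum_congr rfl fun v _ => ?_
  rw [← Finset.sum_add_distrib]
  refine Finset.sum_congr rfl fun w _ => ?_
  split_ifs <;> simp

lemma crossRate_nonneg {n : ℕ} (H : SimpleGraph (Fin n)) (S : Finset (Fin n)) :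
    0 ≤ crossRate H S := by
  unfold crossRate; positivity

lemma crossRate_compl {n : ℕ} (H : SimpleGraph (Fin n)) (S : Finset (Fin n)) :
    crossRate H Sᶜ = crossRate H S := by
  simp only [crossRate, Finset.mem_compl, not_iff_not]

lemma cutDiligence_nonneg {n : ℕ} (H : SimpleGraph (Fin n)) (S : Finset (Fin n)) :
    0 ≤ cutDiligence H S := by
  refine Real.sInf_nonneg ?_
  rintro x ⟨u, -, v, -, -, rfl⟩
  exact le_max_of_le_left (by unfold avgDegree; positivity)

lemma diligence_nonneg {n : ℕ} (H : SimpleGraph (Fin n)) : 0 ≤ diligence H := by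
  unfold diligence
  split_ifs
  · refine Real.sInf_nonneg ?_
    rintro x ⟨S, -, -, -, rfl⟩
    exact cutDiligence_nonneg H S
  · rfl

lemma conductance_nonneg {n : ℕ} (H : SimpleGraph (Fin n)) : 0 ≤ conductance H := by
  refine Real.sInf_nonneg ?_
  rintro x ⟨S, -, -, rfl⟩
  positivity

lemma conductance_le {n : ℕ} (H : SimpleGraph (Fin n)) {S : Finset (Fin n)} (hS : S.Nonempty)
    (hS' : S ⊂ Finset.univ) :
    conductance H ≤ (cutSize H S : ℝ) / (min (vol H S) (vol H Sᶜ) : ℕ) := by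
  refine csInf_le ⟨0, ?_⟩ ⟨S, hS, hS', rfl⟩
  rintro x ⟨S, -, -, rfl⟩
  positivity

lemma diligence_le {n : ℕ} {H : SimpleGraph (Fin n)} (hH : H.Connected) {S : Finset (Fin n)}
    (hS : S ⊂ Finset.univ) (h0 : 0 < vol H S) (h2 : 2 * vol H S ≤ vol H Finset.univ) :
    diligence H ≤ cutDiligence H S := by
  rw [diligence, if_pos hH]
  refine csInf_le ⟨0, ?_⟩ ⟨S, hS, h0, h2, rfl⟩
  rintro x ⟨S, -, -, -, rfl⟩
  exact cutDiligence_nonneg H S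

open Classical in
lemma cutDiligence_le {n : ℕ} (H : SimpleGraph (Fin n)) {S : Finset (Fin n)} {u v : Fin n}
    (hu : u ∈ S) (hv : v ∉ S) (huv : H.Adj u v) :
    cutDiligence H S ≤ avgDegree H S * ((1 : ℝ) / H.degree u + 1 / H.degree v) := by
  have h0 : 0 ≤ avgDegree H S := by unfold avgDegree; positivity
  have h1 : cutDiligence H S ≤ max (avgDegree H S / H.degree u) (avgDegree H S / H.degree v) := by
    refine csInf_le ⟨0, ?_⟩ ⟨u, hu, v, hv, huv, rfl⟩
    rintro x ⟨u, -, v, -, -, rfl⟩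
    exact le_max_of_le_left (by positivity)
  refine h1.trans ?_
  rw [mul_add, mul_one_div, mul_one_div]
  exact max_le_add_of_nonneg (by positivity) (by positivity)

lemma vol_add_vol_compl {n : ℕ} (H : SimpleGraph (Fin n)) (S : Finset (Fin n)) :
    vol H S + vol H Sᶜ = vol H Finset.univ :=
  Finset.sum_add_sum_compl S _

/-- Each edge of the cut contributes at least the diligence over the average degree of `S` to the
rate of contacts, and the conductance bounds the number of these edges from below. -/
lemma card_mul_le_crossRate {n : ℕ} {H : SimpleGraph (Fin n)} (hH : H.Connected)
    {S : Finset (Fin n)} (hS : S.Nonempty) (hS' : S ⊂ Finset.univ) (h0 : 0 < vol H S)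
    (h2 : vol H S ≤ vol H Sᶜ) :
    conductance H * diligence H * S.card ≤ crossRate H S := by
  classical
  have hv : (0 : ℝ) < vol H S := by exact_mod_cast h0
  have hc : (0 : ℝ) < S.card := by exact_mod_cast hS.card_pos
  have h3 := conductance_le H hS hS'
  rw [min_eq_left h2] at h3
  have h4 := diligence_le hH hS' h0 (by have := vol_add_vol_compl H S; omega)
  have h5 : ∀ e ∈ H.interedges S Sᶜ, diligence H * (S.card / vol H S) ≤
      (1 : ℝ) / H.degree e.1 + 1 / H.degree e.2 := by
    rintro ⟨u, v⟩ he
    rw [SimpleGraph.interedges, Rel.mem_interedges_iff, Finset.mem_compl] at he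
    have := h4.trans (cutDiligence_le H he.1 he.2.1 he.2.2)
    rw [avgDegree] at this
    calc diligence H * (S.card / vol H S)
        ≤ _ * (S.card / vol H S) := mul_le_mul_of_nonneg_right this (by positivity)
      _ = _ := by field_simp
  rw [crossRate_eq_sum_interedges]
  calc conductance H * diligence H * S.card
      ≤ cutSize H S / vol H S * diligence H * S.card := by
        have := diligence_nonneg H
        gcongr
    _ = (H.interedges S Sᶜ).card • (diligence H * (S.card / vol H S)) := by
        rw [cutSize, nsmul_eq_mul]
        field_simp
    _ ≤ _ := Finset.card_nsmul_le_sum _ _ _ h5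

lemma min_card_mul_le_crossRate {n : ℕ} (H : SimpleGraph (Fin n)) {S : Finset (Fin n)}
    (hS : S.Nonempty) (hS' : S ⊂ Finset.univ) :
    conductance H * diligence H * min (S.card : ℝ) (n - S.card) ≤ crossRate H S := by
  classical
  by_cases hH : H.Connected
  swap
  · rw [diligence, if_neg hH]
    simpa using crossRate_nonneg H S
  have hcard : ((Sᶜ).card : ℝ) = n - S.card := by
    rw [Finset.card_compl, Fintype.card_fin,
      Nat.cast_sub (by simpa using Finset.card_le_univ S)]
  have hn : Nontrivial (Fin n) := by
    obtain ⟨a, ha⟩ := hS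
    obtain ⟨b, -, hb⟩ := Finset.exists_of_ssubset hS'
    exact ⟨a, b, fun h => hb (h ▸ ha)⟩
  have hvol : ∀ A : Finset (Fin n), A.Nonempty → 0 < vol H A := fun A hA =>
    Finset.sum_pos (fun v _ => hH.preconnected.degree_pos_of_nontrivial v) hA
  have hne : (Sᶜ).Nonempty := by
    obtain ⟨b, -, hb⟩ := Finset.exists_of_ssubset hS'
    exact ⟨b, Finset.mem_compl.2 hb⟩
  have hss : Sᶜ ⊂ Finset.univ := by
    rw [Finset.ssubset_univ_iff]
    intro h
    simp [Finset.compl_eq_univ_iff] at h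
    simp [h] at hS
  have hnn : 0 ≤ conductance H * diligence H :=
    mul_nonneg (conductance_nonneg H) (diligence_nonneg H)
  rcases le_total (vol H S) (vol H Sᶜ) with h | h
  · exact (mul_le_mul_of_nonneg_left (min_le_left _ _) hnn).trans
      (card_mul_le_crossRate hH hS hS' (hvol S hS) h)
  · rw [← crossRate_compl]
    refine (mul_le_mul_of_nonneg_left (min_le_right _ _) hnn).trans ?_
    rw [← hcard]
    exact card_mul_le_crossRate hH hne hss (hvol _ hne) (by rwa [compl_compl])

/-- A crude bound: a balanced set shows that the product of conductance and diligence is at most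
`n / ⌊n / 2⌋`. -/
lemma conductance_mul_diligence_le {n : ℕ} (hn : 2 ≤ n) (H : SimpleGraph (Fin n)) :
    conductance H * diligence H ≤ 3 := by
  obtain ⟨S, -, hS⟩ := Finset.exists_subset_card_eq
    (s := (Finset.univ : Finset (Fin n))) (n := n / 2) (by simp; omega)
  have hne : S.Nonempty := Finset.card_pos.1 (by omega)
  have hss : S ⊂ Finset.univ := by
    rw [Finset.ssubset_univ_iff]
    rintro rfl
    simp at hS
    omega
  have h1 := (min_card_mul_le_crossRate H hne hss).trans (crossRate_le H S)
  have hpos : (0 : ℝ) < n := by positivity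
  have h3 : (n : ℝ) / 3 ≤ min (S.card : ℝ) (n - S.card) := by
    rw [hS]
    have a : (n : ℝ) ≤ 3 * (n / 2 : ℕ) := by exact_mod_cast (by omega : n ≤ 3 * (n / 2))
    have b : (2 : ℝ) * (n / 2 : ℕ) ≤ n := by exact_mod_cast Nat.mul_div_le n 2
    exact le_min (by linarith) (by linarith)
  have h4 := mul_le_mul_of_nonneg_left h3
    (mul_nonneg (conductance_nonneg H) (diligence_nonneg H))
  by_contra! hcon
  nlinarith

/-! ### Spreading during one period -/

open Classical in
/-- The nodes that know the rumor after the period `(s, s + δ)` if those in `S` know it before and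
`H` is in force, where only direct contacts with members of `S` are counted. -/
noncomputable def spread {n : ℕ} (H : SimpleGraph (Fin n)) (S : Finset (Fin n)) (s δ : ℝ)
    (ω : Outcome n) : Finset (Fin n) :=
  S ∪ Finset.univ.filter fun w => ∃ u ∈ S, (∃ τ ∈ Set.Ioo s (s + δ), Calls (fun _ => H) ω τ u w) ∨
    ∃ τ ∈ Set.Ioo s (s + δ), Calls (fun _ => H) ω τ w u

lemma measurableSet_past_calls {n : ℕ} (H : SimpleGraph (Fin n)) (s δ : ℝ) (u w : Fin n) :
    MeasurableSet[past n (s + δ)]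
      {ω | ∃ τ ∈ Set.Ioo s (s + δ), Calls (fun _ => H) ω τ u w} := by
  classical
  constructor
  · have h : {ω : Outcome n | ∃ τ ∈ Set.Ioo s (s + δ), Calls (fun _ => H) ω τ u w} =
        ⋃ k, {ω | s < tickTime ω u k} ∩ {ω | tickTime ω u k < s + δ} ∩
          {ω | (ω (u, k)).2 ∈ {π | H.Adj u w ∧ π (H.neighborFinset u) = w}} := by
      ext ω
      simp only [Calls, Set.mem_Ioo, Set.mem_ofPred_eq, Set.mem_iUnion, Set.mem_inter_iff]
      constructor
      · rintro ⟨τ, ⟨h1, h2⟩, k, rfl, h3, h4⟩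
        exact ⟨k, ⟨h1, h2⟩, h3, by convert h4⟩
      · rintro ⟨k, ⟨h1, h2⟩, h3, h4⟩
        exact ⟨_, ⟨h1, h2⟩, k, rfl, h3, by convert h4⟩
    rw [h]
    refine MeasurableSet.iUnion fun k => ((measurableSet_lt measurable_const
      (measurable_tickTime u k)).inter
      (measurableSet_lt (measurable_tickTime u k) measurable_const)).inter ?_
    exact (measurable_snd.comp (measurable_pi_apply (u, k))) (Set.toFinite _).measurableSet
  · rintro ω ω' hag ⟨τ, hτ, k, rfl, h3, h4⟩
    obtain ⟨h5, h6⟩ := hag u k (Or.inl hτ.2.le)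
    exact ⟨tickTime ω' u k, h5 ▸ hτ, k, rfl, h3, h6 ▸ h4⟩

lemma measurableSet_past_spread {n : ℕ} (H : SimpleGraph (Fin n)) (S S' : Finset (Fin n))
    (s δ : ℝ) : MeasurableSet[past n (s + δ)] {ω | spread H S s δ ω = S'} := by
  classical
  have h : ∀ w, MeasurableSet[past n (s + δ)] {ω | w ∈ spread H S s δ ω} := by
    intro w
    have : {ω | w ∈ spread H S s δ ω} = {_ω | w ∈ S} ∪ ⋃ u, ⋃ _ : u ∈ S,
        ({ω | ∃ τ ∈ Set.Ioo s (s + δ), Calls (fun _ => H) ω τ u w} ∪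
          {ω | ∃ τ ∈ Set.Ioo s (s + δ), Calls (fun _ => H) ω τ w u}) := by
      ext; simp [spread]
    rw [this]
    exact (@MeasurableSet.const _ (past n (s + δ)) _).union (MeasurableSet.iUnion fun u =>
      MeasurableSet.iUnion fun _ =>
        (measurableSet_past_calls H s δ u w).union (measurableSet_past_calls H s δ w u))
  have h' : {ω | spread H S s δ ω = S'} = ⋂ w, {ω | w ∈ spread H S s δ ω ↔ w ∈ S'} := by
    ext; simp [Finset.ext_iff]
  rw [h']
  refine MeasurableSet.iInter fun w => ?_
  by_cases hw : w ∈ S'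
  · simpa [hw] using h w
  · simp only [hw, iff_false]
    exact (h w).compl

lemma subset_spread {n : ℕ} (H : SimpleGraph (Fin n)) (S : Finset (Fin n)) (s δ : ℝ)
    (ω : Outcome n) : S ⊆ spread H S s δ ω := by
  classical
  exact Finset.subset_union_left

open Classical in
lemma mem_noTick_of_spread_eq {n : ℕ} {H : SimpleGraph (Fin n)} {S : Finset (Fin n)} {s δ : ℝ}
    {ω : Outcome n} (h : spread H S s δ ω = S) :
    ω ∈ noTick s δ (crossPicks H S fun v => H.neighborFinset v) := by
  rintro v k h1 h2 ⟨h3, h4⟩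
  have hc : ∃ τ ∈ Set.Ioo s (s + δ), Calls (fun _ => H) ω τ v
      ((ω (v, k)).2 (H.neighborFinset v)) := ⟨_, ⟨h1, h2⟩, k, rfl, h3, rfl⟩
  have hsub : ∀ w, (∃ u ∈ S, (∃ τ ∈ Set.Ioo s (s + δ), Calls (fun _ => H) ω τ u w) ∨
      ∃ τ ∈ Set.Ioo s (s + δ), Calls (fun _ => H) ω τ w u) → w ∈ S := by
    intro w hw
    rw [← h, spread]
    exact Finset.mem_union_right _ (by simpa using hw)
  exact h4 ⟨fun hv => hsub _ ⟨v, hv, Or.inl hc⟩, fun hw => hsub _ ⟨_, hw, Or.inr hc⟩⟩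

/-! ### The potential and the maximal inequality -/

/-- The potential `φ k = n / k - 1` of a set of `k` informed nodes. Its decrements satisfy
`min k (n - k) * (φ k - φ (k + 1)) ≥ φ k / 2` for `1 ≤ k < n`, see `half_potential_le`. -/
noncomputable def potential (n k : ℕ) : ℝ := n / k - 1

lemma potential_nonneg {n k : ℕ} (hk : 1 ≤ k) (hkn : k ≤ n) : 0 ≤ potential n k := by
  have : (0 : ℝ) < k := by exact_mod_cast hk
  rw [potential, sub_nonneg, one_le_div this]
  exact_mod_cast hkn

lemma potential_anti {n k l : ℕ} (hk : 1 ≤ k) (hkl : k ≤ l) : potential n l ≤ potential n k := by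
  have : (0 : ℝ) < k := by exact_mod_cast hk
  have : (k : ℝ) ≤ l := by exact_mod_cast hkl
  unfold potential
  gcongr

lemma half_potential_le {n k : ℕ} (hk : 1 ≤ k) (hkn : k < n) :
    potential n k / 2 ≤
      (potential n k - potential n (k + 1)) * min (k : ℝ) (n - k) := by
  have hk0 : (1 : ℝ) ≤ k := by exact_mod_cast hk
  have hkn' : (k : ℝ) + 1 ≤ n := by exact_mod_cast hkn
  have e1 : potential n k = (n - k) / k := by
    rw [potential]; field_simp
  have e2 : potential n k - potential n (k + 1) = n / (k * (k + 1)) := by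
    rw [potential, potential]; push_cast; field_simp; ring
  rw [e2, e1, div_mul_eq_mul_div, div_div, div_le_div_iff₀ (by positivity) (by positivity)]
  rcases min_choice (k : ℝ) (n - k) with h | h <;> rw [h]
  · have : ((n : ℝ) - k) * (k + 1) ≤ n * (2 * k) := by nlinarith
    nlinarith
  · have : ((k : ℝ) + 1) ≤ n * 2 := by linarith
    have h2 : 0 ≤ ((n : ℝ) - k) * k := mul_nonneg (by linarith) (by linarith)
    nlinarith [mul_le_mul_of_nonneg_left this h2]

lemma exp_neg_le_one_sub_half {x : ℝ} (h0 : 0 ≤ x) (h1 : x ≤ 1) : Real.exp (-x) ≤ 1 - x / 2 := by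
  rw [Real.exp_neg, inv_le_comm₀ (Real.exp_pos x) (by linarith)]
  refine le_trans ?_ (Real.add_one_le_exp x)
  rw [inv_le_iff_one_le_mul₀ (by linarith)]
  nlinarith

/-- The potential decreases at rate at least `l / (8 * n)` per period of length `1 / n` if the
informed set has size `k` and the contacts across its boundary have rate `r`. -/
lemma exp_mul_potential_le {n k : ℕ} (hk : 1 ≤ k) (hkn : k < n) {l r : ℝ}
    (hl : 0 ≤ l) (hr : l * min (k : ℝ) (n - k) ≤ r) (hrn : r ≤ n) :
    Real.exp (l / (8 * n)) * (potential n (k + 1) + (potential n k - potential n (k + 1)) *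
      Real.exp (-((1 - Real.exp (-(1 / n))) * r))) ≤ potential n k := by
  have hk0 : (1 : ℝ) ≤ k := by exact_mod_cast hk
  have hkn' : (k : ℝ) + 1 ≤ n := by exact_mod_cast hkn
  have hn : (0 : ℝ) < n := by linarith
  have hm : 0 ≤ min (k : ℝ) (n - k) := le_min (by linarith) (by linarith)
  have hr0 : 0 ≤ r := (mul_nonneg hl hm).trans hr
  have hφ := potential_nonneg hk hkn.le
  have hΔ : 0 ≤ potential n k - potential n (k + 1) :=
    sub_nonneg.2 (potential_anti hk (Nat.le_succ k))
  have hinv : 1 / (n : ℝ) ≤ 1 := (div_le_one hn).2 (by linarith)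
  have hp1 : (1 / (n : ℝ)) / 2 ≤ 1 - Real.exp (-(1 / n)) := by
    linarith [exp_neg_le_one_sub_half (by positivity) hinv]
  have hp2 : 1 - Real.exp (-(1 / (n : ℝ))) ≤ 1 / n := by
    linarith [Real.add_one_le_exp (-(1 / (n : ℝ)))]
  have hpr : (1 - Real.exp (-(1 / (n : ℝ)))) * r ≤ 1 := by
    calc _ ≤ 1 / (n : ℝ) * n := by gcongr
      _ = 1 := by field_simp
  have hpr0 : 0 ≤ (1 - Real.exp (-(1 / (n : ℝ)))) * r :=
    mul_nonneg (by have : 0 ≤ 1 / (n : ℝ) / 2 := by positivity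
                   linarith) hr0
  have hexp : Real.exp (-((1 - Real.exp (-(1 / n))) * r)) ≤
      1 - l * min (k : ℝ) (n - k) / (4 * n) := by
    have : l * min (k : ℝ) (n - k) / (4 * n) ≤ (1 - Real.exp (-(1 / (n : ℝ)))) * r / 2 := by
      calc l * min (k : ℝ) (n - k) / (4 * n) ≤ r / (4 * n) := by gcongr
        _ = (1 / (n : ℝ)) / 2 * r / 2 := by field_simp; ring
        _ ≤ _ := by gcongr
    linarith [exp_neg_le_one_sub_half hpr0 hpr]
  have hkey : potential n (k + 1) + (potential n k - potential n (k + 1)) *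
      Real.exp (-((1 - Real.exp (-(1 / n))) * r)) ≤
      potential n k * Real.exp (-(l / (8 * n))) := by
    have h1 := mul_le_mul_of_nonneg_left hexp hΔ
    have h2 := mul_le_mul_of_nonneg_left (half_potential_le hk hkn)
      (by positivity : 0 ≤ l / (4 * n))
    have h3 := mul_le_mul_of_nonneg_left (Real.one_sub_le_exp_neg (l / (8 * n))) hφ
    have e1 : l / (4 * n) * (potential n k / 2) = potential n k * (l / (8 * n)) := by
      field_simp; ring
    have e2 : l / (4 * n) * ((potential n k - potential n (k + 1)) * min (k : ℝ) (n - k)) =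
      (potential n k - potential n (k + 1)) * (l * min (k : ℝ) (n - k) / (4 * n)) := by
      field_simp
    rw [e1, e2] at h2
    linarith
  calc _ ≤ Real.exp (l / (8 * n)) * (potential n k * Real.exp (-(l / (8 * n)))) := by gcongr
    _ = potential n k := by
      rw [mul_left_comm, ← Real.exp_add, add_neg_cancel, Real.exp_zero, mul_one]

open Classical in
lemma noTickProb_crossPicks_le {n : ℕ} (δ : ℝ) (H : SimpleGraph (Fin n))
    (S : Finset (Fin n)) : noTickProb δ (crossPicks H S fun v => H.neighborFinset v) ≤
      ENNReal.ofReal (Real.exp (-((1 - Real.exp (-δ)) * crossRate H S))) := by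
  rw [noTickProb, crossRate, Finset.mul_sum, ← Finset.sum_neg_distrib, Real.exp_sum,
    ENNReal.ofReal_prod_of_nonneg fun v _ => (Real.exp_pos _).le]
  refine Finset.prod_le_prod' fun v _ => ENNReal.ofReal_le_ofReal ?_
  rw [pickLaw_crossPicks]
  exact Real.one_sub_le_exp_neg _

/-- The maximal inequality for nonnegative supermartingales, where the supermartingale property is
only demanded on the events that no previous value has reached `y`. -/
lemma measure_exists_le_le {Ω : Type*} [MeasurableSpace Ω] (μ : Measure Ω)
    {M : ℕ → Ω → ENNReal} (hM : ∀ j, Measurable (M j)) (y : ENNReal)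
    (h : ∀ j, ∫⁻ ω in {ω | ∀ i ≤ j, M i ω < y}, M (j + 1) ω ∂μ ≤
      ∫⁻ ω in {ω | ∀ i ≤ j, M i ω < y}, M j ω ∂μ) :
    y * μ {ω | ∃ j, y ≤ M j ω} ≤ ∫⁻ ω, M 0 ω ∂μ := by
  have hlow : ∀ j, MeasurableSet {ω | ∀ i < j, M i ω < y} := fun j => by
    have : {ω | ∀ i < j, M i ω < y} = ⋂ i, ⋂ _ : i < j, {ω | M i ω < y} := by ext; simp
    rw [this]
    exact MeasurableSet.iInter fun i => MeasurableSet.iInter fun _ =>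
      measurableSet_lt (hM i) measurable_const
  have key : ∀ j, y * μ {ω | ∃ i < j, y ≤ M i ω} + ∫⁻ ω in {ω | ∀ i < j, M i ω < y}, M j ω ∂μ ≤
      ∫⁻ ω, M 0 ω ∂μ := by
    intro j
    induction j with
    | zero => simp
    | succ j ih =>
      refine le_trans ?_ ih
      have hset : {ω | ∃ i < j + 1, y ≤ M i ω} ⊆ {ω | ∃ i < j, y ≤ M i ω} ∪
          ({ω | ∀ i < j, M i ω < y} ∩ {ω | y ≤ M j ω}) := by
        rintro ω ⟨i, hi, hy⟩
        by_cases hex : ∃ i < j, y ≤ M i ω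
        · exact Or.inl hex
        · push Not at hex
          obtain rfl : i = j := by
            by_contra hne
            exact absurd hy (not_le.2 (hex i (by omega)))
          exact Or.inr ⟨hex, hy⟩
      have hstep := h j
      have heq : {ω | ∀ i ≤ j, M i ω < y} = {ω | ∀ i < j, M i ω < y} \ {ω | y ≤ M j ω} := by
        ext ω
        simp only [Set.mem_ofPred_eq, Set.mem_sdiff, not_le]
        exact ⟨fun hh => ⟨fun i hi => hh i hi.le, hh j le_rfl⟩,
          fun hh i hi => hi.lt_or_eq.elim (hh.1 i) fun e => e ▸ hh.2⟩
      have hy : MeasurableSet {ω | y ≤ M j ω} := measurableSet_le measurable_const (hM j)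
      rw [← lintegral_inter_add_sdiff (M j) {ω | ∀ i < j, M i ω < y} hy, ← heq, ← add_assoc]
      simp only [Order.lt_add_one_iff] at hset ⊢
      refine add_le_add ?_ hstep
      calc y * μ {ω | ∃ i ≤ j, y ≤ M i ω}
          ≤ y * (μ {ω | ∃ i < j, y ≤ M i ω} + μ ({ω | ∀ i < j, M i ω < y} ∩ {ω | y ≤ M j ω})) := by
            gcongr
            exact (measure_mono hset).trans (measure_union_le _ _)
        _ ≤ _ := by
            rw [mul_add]
            gcongr
            rw [← setLIntegral_const]
            exact setLIntegral_mono (hM j) fun ω hω => hω.2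
  have hmono : Monotone fun j : ℕ => {ω | ∃ i < j, y ≤ M i ω} :=
    fun a b hab ω ⟨i, hi, hy⟩ => ⟨i, hi.trans_le hab, hy⟩
  have hU : {ω | ∃ j, y ≤ M j ω} = ⋃ j, {ω | ∃ i < j, y ≤ M i ω} := by
    ext ω
    simp only [Set.mem_ofPred_eq, Set.mem_iUnion]
    exact ⟨fun ⟨j, hj⟩ => ⟨j + 1, j, Nat.lt_succ_self j, hj⟩, fun ⟨_, i, _, hi⟩ => ⟨i, hi⟩⟩
  rw [hU, hmono.measure_iUnion, ENNReal.mul_iSup]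
  exact iSup_le fun j => le_self_add.trans (key j)

/-! ### The supermartingale -/

lemma calls_congr {n : ℕ} {G G' : ℕ → SimpleGraph (Fin n)} {ω : Outcome n} {τ : ℝ} {v u : Fin n}
    (h : G ⌊τ⌋₊ = G' ⌊τ⌋₊) (hc : Calls G ω τ v u) : Calls G' ω τ v u := by
  unfold Calls at *
  rwa [← h]

/-- A lower bound for the set of informed nodes at time `j / n`, where of the contacts in each
period `(i / n, (i + 1) / n)` only those with nodes informed before the period are counted. -/
noncomputable def informedAt {n : ℕ} (G : ℕ → Outcome n → SimpleGraph (Fin n)) (v₀ : Fin n) :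
    ℕ → Outcome n → Finset (Fin n)
  | 0, _ => {v₀}
  | j + 1, ω => spread (G (j / n) ω) (informedAt G v₀ j ω) (j / n) (1 / n) ω

lemma informed_mono {n : ℕ} {G : ℕ → SimpleGraph (Fin n)} {v₀ : Fin n} {ω : Outcome n} {σ τ : ℝ}
    {v : Fin n} (hστ : σ ≤ τ) (h : Informed G v₀ ω σ v) : Informed G v₀ ω τ v := by
  cases h with
  | source h0 => exact .source (h0.trans hστ)
  | contact h1 h2 h3 => exact .contact h1 h2 (h3.trans hστ)

lemma floor_of_mem_Ioo {n : ℕ} (hn : 0 < n) (j : ℕ) {τ : ℝ}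
    (hτ : τ ∈ Set.Ioo ((j : ℝ) / n) (j / n + 1 / n)) : ⌊τ⌋₊ = j / n := by
  have hn' : (0 : ℝ) < n := by exact_mod_cast hn
  have h1 : ((j / n : ℕ) : ℝ) ≤ j / n := Nat.cast_div_le
  rw [Nat.floor_eq_iff ((by positivity : (0 : ℝ) ≤ j / n).trans hτ.1.le)]
  refine ⟨h1.trans hτ.1.le, hτ.2.trans_le ?_⟩
  rw [← add_div, div_le_iff₀ hn']
  have := Nat.lt_mul_div_succ j hn
  rw [mul_comm] at this
  exact_mod_cast this

lemma informed_of_mem_informedAt {n : ℕ} (hn : 0 < n) (G : ℕ → Outcome n → SimpleGraph (Fin n))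
    (v₀ : Fin n) (ω : Outcome n) (j : ℕ) :
    ∀ v ∈ informedAt G v₀ j ω, Informed (fun t => G t ω) v₀ ω ((j : ℝ) / n) v := by
  classical
  induction j with
  | zero =>
    intro v hv
    rw [informedAt, Finset.mem_singleton] at hv
    subst hv
    exact .source (by simp)
  | succ j ih =>
    intro v hv
    have hle : (j : ℝ) / n + 1 / n = ((j + 1 : ℕ) : ℝ) / n := by push_cast; ring
    rw [informedAt, spread, Finset.mem_union, Finset.mem_filter] at hv
    rcases hv with hv | ⟨-, u, hu, ⟨τ, hτ, hc⟩ | ⟨τ, hτ, hc⟩⟩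
    · exact informed_mono (by rw [← hle]; exact le_add_of_nonneg_right (by positivity)) (ih v hv)
    all_goals
      have hG := floor_of_mem_Ioo hn j hτ
      refine .contact (informed_mono hτ.1.le (ih u hu)) ?_ (hle ▸ hτ.2.le)
    · exact Or.inl (calls_congr (by rw [hG]) hc)
    · exact Or.inr (calls_congr (by rw [hG]) hc)

section Network

variable {n : ℕ} {G : ℕ → Outcome n → SimpleGraph (Fin n)} {v₀ : Fin n}

lemma measurableSet_past_graph (hG : IsDynamicNetwork G) (j : ℕ) (H : SimpleGraph (Fin n)) :
    MeasurableSet[past n ((j : ℝ) / n)] {ω | G (j / n) ω = H} := by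
  refine ⟨hG.measurableSet_eq _ H, fun ω ω' h hω => ?_⟩
  rw [Set.mem_ofPred_eq, ← hG.nonanticipating (j / n) ω ω' (h.mono Nat.cast_div_le)]
  exact hω

lemma measurableSet_past_informedAt (hG : IsDynamicNetwork G) (j : ℕ) (S : Finset (Fin n)) :
    MeasurableSet[past n ((j : ℝ) / n)] {ω | informedAt G v₀ j ω = S} := by
  induction j generalizing S with
  | zero => exact @MeasurableSet.const _ (past n _) ({v₀} = S)
  | succ j ih =>
    have hle : (j : ℝ) / n + 1 / n = ((j + 1 : ℕ) : ℝ) / n := by push_cast; ring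
    have hm : past n ((j : ℝ) / n) ≤ past n (((j + 1 : ℕ) : ℝ) / n) :=
      past_mono n (by rw [← hle]; exact le_add_of_nonneg_right (by positivity))
    have h : {ω | informedAt G v₀ (j + 1) ω = S} = ⋃ H, ⋃ S₀, {ω | G (j / n) ω = H} ∩
        {ω | informedAt G v₀ j ω = S₀} ∩ {ω | spread H S₀ (j / n) (1 / n) ω = S} := by
      ext ω; simp [informedAt]
    rw [h]
    refine MeasurableSet.iUnion fun H => MeasurableSet.iUnion fun S₀ =>
      ((hm _ (measurableSet_past_graph hG j H)).inter (hm _ (ih S₀))).inter ?_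
    rw [← hle]
    exact measurableSet_past_spread H S₀ S _ _

lemma measurable_comp_of_fibers {Ω ι β : Type*} [Finite ι] [MeasurableSpace β]
    {m : MeasurableSpace Ω} {X : Ω → ι} (hX : ∀ i, MeasurableSet {ω | X ω = i}) (f : ι → β) :
    Measurable fun ω => f (X ω) := by
  let _ : MeasurableSpace ι := ⊤
  have : Measurable X := measurable_to_countable' fun i => hX i
  exact measurable_from_top.comp this

/-- The product of conductance and diligence of the graph in force during
`[i / n, (i + 1) / n)`, summed over `i < j`. -/
noncomputable def accumulated (G : ℕ → Outcome n → SimpleGraph (Fin n)) (j : ℕ)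
    (ω : Outcome n) : ℝ :=
  ∑ i ∈ Finset.range j, conductance (G (i / n) ω) * diligence (G (i / n) ω)

lemma measurable_past_accumulated (hG : IsDynamicNetwork G) (j : ℕ) :
    Measurable[past n ((j : ℝ) / n)] (accumulated G j) := by
  unfold accumulated
  refine Finset.measurable_fun_sum _ fun i hi => ?_
  have hij : (i : ℝ) ≤ j := by exact_mod_cast (Finset.mem_range.1 hi).le
  exact measurable_comp_of_fibers (m := past n ((j : ℝ) / n)) (fun H => past_mono n (by gcongr) _
    (measurableSet_past_graph hG i H)) fun H => conductance H * diligence H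

/-- The exponential weight of the process at time `j / n`. -/
noncomputable def weight (G : ℕ → Outcome n → SimpleGraph (Fin n)) (j : ℕ)
    (ω : Outcome n) : ENNReal :=
  ENNReal.ofReal (Real.exp (accumulated G j ω / (8 * n)))

lemma measurable_past_weight (hG : IsDynamicNetwork G) (j : ℕ) :
    Measurable[past n ((j : ℝ) / n)] (weight G j) :=
  ENNReal.measurable_ofReal.comp (Real.measurable_exp.comp
    ((measurable_id.div_const _).comp (measurable_past_accumulated hG j)))

/-- The supermartingale: the potential of the informed set, weighted by the exponential of the
accumulated products of conductance and diligence. -/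
noncomputable def weightedPotential (G : ℕ → Outcome n → SimpleGraph (Fin n)) (v₀ : Fin n)
    (j : ℕ) (ω : Outcome n) : ENNReal :=
  ENNReal.ofReal (potential n (informedAt G v₀ j ω).card) * weight G j ω

lemma measurable_past_weightedPotential (hG : IsDynamicNetwork G) (j : ℕ) :
    Measurable[past n ((j : ℝ) / n)] (weightedPotential G v₀ j) :=
  Measurable.fun_mul (m := past n ((j : ℝ) / n))
    (measurable_comp_of_fibers (m := past n ((j : ℝ) / n))
      (measurableSet_past_informedAt hG j) fun S => ENNReal.ofReal (potential n S.card))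
    (measurable_past_weight hG j)

lemma weight_succ (j : ℕ) (ω : Outcome n) : weight G (j + 1) ω =
    ENNReal.ofReal (Real.exp (conductance (G (j / n) ω) * diligence (G (j / n) ω) / (8 * n))) *
      weight G j ω := by
  rw [weight, weight, accumulated, accumulated, Finset.sum_range_succ, add_div, Real.exp_add,
    ENNReal.ofReal_mul (Real.exp_pos _).le, mul_comm]

/-- The supermartingale inequality for fixed values of the graph in force and of the informed
set, with a weight `f` that depends on the past. -/
lemma lintegral_potential_spread_le (H : SimpleGraph (Fin n)) (S : Finset (Fin n)) {s : ℝ}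
    (hs : 0 ≤ s) {f : Outcome n → ENNReal} (hf : Measurable[past n s] f) :
    ∫⁻ ω, ENNReal.ofReal (potential n (spread H S s (1 / n) ω).card) *
        (ENNReal.ofReal (Real.exp (conductance H * diligence H / (8 * n))) * f ω) ∂outcomeLaw n ≤
      ∫⁻ ω, ENNReal.ofReal (potential n S.card) * f ω ∂outcomeLaw n := by
  classical
  have hf' : Measurable f := hf.mono (past_le n s) le_rfl
  rcases S.eq_empty_or_nonempty with rfl | hne
  -- An empty set does not grow. The junk value `n / 0 - 1` of its potential is negative.
  · have : ∀ ω, spread H ∅ s (1 / n) ω = ∅ := fun ω => by simp [spread]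
    have hz : potential n (∅ : Finset (Fin n)).card ≤ 0 := by simp [potential]
    simp_rw [this, ENNReal.ofReal_of_nonpos hz]
    simp
  by_cases huniv : S = Finset.univ
  · subst huniv
    have : ∀ ω, spread H Finset.univ s (1 / n) ω = Finset.univ := fun ω =>
      Finset.univ_subset_iff.1 (subset_spread _ _ _ _ _)
    have hz : potential n (Finset.univ : Finset (Fin n)).card ≤ 0 := by
      rw [potential, Finset.card_univ, Fintype.card_fin]
      linarith [div_self_le_one (n : ℝ)]
    simp_rw [this, ENNReal.ofReal_of_nonpos hz]
    simp
  have hss : S ⊂ Finset.univ := Finset.ssubset_univ_iff.2 huniv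
  have hk : 1 ≤ S.card := hne.card_pos
  have hkn : S.card < n := by simpa using Finset.card_lt_card hss
  set B := crossPicks H S fun v => H.neighborFinset v with hB
  set a := potential n (S.card + 1) with ha
  set d := potential n S.card - potential n (S.card + 1) with hd
  set e := Real.exp (conductance H * diligence H / (8 * n)) with he
  have ha0 : 0 ≤ a := potential_nonneg (by omega) hkn
  have hd0 : 0 ≤ d := sub_nonneg.2 (potential_anti hk (Nat.le_succ _))
  have he0 : 0 ≤ e := (Real.exp_pos _).le
  have hpt : ∀ ω, ENNReal.ofReal (potential n (spread H S s (1 / n) ω).card) ≤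
      ENNReal.ofReal a + ENNReal.ofReal d * (noTick s (1 / n) B).indicator 1 ω := by
    intro ω
    by_cases h : spread H S s (1 / n) ω = S
    · rw [h, Set.indicator_of_mem (mem_noTick_of_spread_eq h), Pi.one_apply, mul_one,
        ← ENNReal.ofReal_add ha0 hd0, ha, hd, add_sub_cancel]
    · have hlt : S.card < (spread H S s (1 / n) ω).card := Finset.card_lt_card
        ((subset_spread _ _ _ _ _).ssubset_of_ne (Ne.symm h))
      exact (ENNReal.ofReal_le_ofReal (potential_anti (by omega) hlt)).trans le_self_add
  have hno := measurableSet_noTick s (1 / (n : ℝ)) B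
  have hreal := exp_mul_potential_le hk hkn
    (mul_nonneg (conductance_nonneg H) (diligence_nonneg H))
    (min_card_mul_le_crossRate H hne hss) (crossRate_le H S)
  calc _ ≤ ∫⁻ ω, ENNReal.ofReal e * (ENNReal.ofReal a * f ω +
          ENNReal.ofReal d * (noTick s (1 / n) B).indicator f ω) ∂outcomeLaw n := by
        refine lintegral_mono fun ω => ?_
        refine (mul_le_mul_left (hpt ω) _).trans (le_of_eq ?_)
        by_cases h : ω ∈ noTick s (1 / n) B
        · rw [Set.indicator_of_mem h, Set.indicator_of_mem h, Pi.one_apply]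
          ring
        · rw [Set.indicator_of_notMem h, Set.indicator_of_notMem h]
          ring
    _ = ENNReal.ofReal e * (ENNReal.ofReal a * ∫⁻ ω, f ω ∂outcomeLaw n +
          ENNReal.ofReal d * ∫⁻ ω in noTick s (1 / n) B, f ω ∂outcomeLaw n) := by
        rw [lintegral_const_mul _ (by fun_prop (disch := assumption)),
          lintegral_add_left (by fun_prop), lintegral_const_mul _ hf',
          lintegral_const_mul _ (hf'.indicator hno), lintegral_indicator hno]
    _ ≤ ENNReal.ofReal e * (ENNReal.ofReal a * ∫⁻ ω, f ω ∂outcomeLaw n +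
          ENNReal.ofReal d * (ENNReal.ofReal (Real.exp (-((1 - Real.exp (-(1 / n))) *
            crossRate H S))) * ∫⁻ ω, f ω ∂outcomeLaw n)) := by
        gcongr
        exact (setLIntegral_noTick_le hs (by positivity) hf B).trans
          (mul_le_mul_left (noTickProb_crossPicks_le _ H S) _)
    _ = ENNReal.ofReal (e * (a + d * Real.exp (-((1 - Real.exp (-(1 / n))) * crossRate H S)))) *
          ∫⁻ ω, f ω ∂outcomeLaw n := by
        rw [ENNReal.ofReal_mul he0, ENNReal.ofReal_add ha0 (by positivity),
          ENNReal.ofReal_mul hd0]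
        ring
    _ ≤ ENNReal.ofReal (potential n S.card) * ∫⁻ ω, f ω ∂outcomeLaw n := by
        gcongr
    _ = _ := (lintegral_const_mul _ hf').symm

lemma setLIntegral_weightedPotential_succ_le (hG : IsDynamicNetwork G) (j : ℕ)
    {B : Set (Outcome n)} (hB : MeasurableSet[past n ((j : ℝ) / n)] B) :
    ∫⁻ ω in B, weightedPotential G v₀ (j + 1) ω ∂outcomeLaw n ≤
      ∫⁻ ω in B, weightedPotential G v₀ j ω ∂outcomeLaw n := by
  set F : SimpleGraph (Fin n) × Finset (Fin n) → Set (Outcome n) := fun x =>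
    B ∩ ({ω | G (j / n) ω = x.1} ∩ {ω | informedAt G v₀ j ω = x.2}) with hF
  have hFm : ∀ x, MeasurableSet[past n ((j : ℝ) / n)] (F x) := fun x =>
    hB.inter ((measurableSet_past_graph hG j x.1).inter (measurableSet_past_informedAt hG j x.2))
  have hBU : B = ⋃ x, F x := by
    ext ω
    simp [hF]
  have hdisj : Pairwise (Function.onFun Disjoint F) := by
    intro x y hxy
    refine Set.disjoint_left.2 fun ω hx hy => hxy (Prod.ext ?_ ?_)
    · exact hx.2.1.symm.trans hy.2.1
    · exact hx.2.2.symm.trans hy.2.2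
  rw [hBU, lintegral_iUnion (fun x => (hFm x).1) hdisj, lintegral_iUnion (fun x => (hFm x).1) hdisj]
  refine ENNReal.tsum_le_tsum fun x => ?_
  have hmain := lintegral_potential_spread_le x.1 x.2 (s := (j : ℝ) / n) (by positivity)
    (f := (F x).indicator (weight G j))
    ((measurable_past_weight hG j).indicator (hFm x))
  rw [← lintegral_indicator (hFm x).1, ← lintegral_indicator (hFm x).1]
  refine le_of_eq_of_le (lintegral_congr fun ω => ?_)
    (hmain.trans (le_of_eq (lintegral_congr fun ω => ?_)))
  · by_cases h : ω ∈ F x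
    · have h1 : G (j / n) ω = x.1 := h.2.1
      have h2 : informedAt G v₀ j ω = x.2 := h.2.2
      rw [Set.indicator_of_mem h, Set.indicator_of_mem h, weightedPotential, weight_succ,
        informedAt, h1, h2]
    · simp [h]
  · by_cases h : ω ∈ F x
    · have h2 : informedAt G v₀ j ω = x.2 := h.2.2
      rw [Set.indicator_of_mem h, Set.indicator_of_mem h, weightedPotential, h2]
    · simp [h]

lemma measure_exists_le_weightedPotential (hn : 0 < n) (hG : IsDynamicNetwork G) (y : ENNReal) :
    y * outcomeLaw n {ω | ∃ j, y ≤ weightedPotential G v₀ j ω} ≤ ENNReal.ofReal (n - 1) := by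
  refine (measure_exists_le_le _ (fun j => (measurable_past_weightedPotential hG j).mono
    (past_le n _) le_rfl) y fun j => setLIntegral_weightedPotential_succ_le hG j ?_).trans ?_
  · have : {ω | ∀ i ≤ j, weightedPotential G v₀ i ω < y} =
        ⋂ i, ⋂ _ : i ≤ j, {ω | weightedPotential G v₀ i ω < y} := by ext; simp
    rw [this]
    refine MeasurableSet.iInter fun i => MeasurableSet.iInter fun hi => ?_
    have hij : (i : ℝ) ≤ j := by exact_mod_cast hi
    exact past_mono n (by gcongr) _
      (measurable_past_weightedPotential hG i measurableSet_Iio)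
  · simp [weightedPotential, weight, accumulated, informedAt, potential]

lemma accumulated_mul (hn : 0 < n) (T : ℕ) (ω : Outcome n) :
    accumulated G (T * n) ω =
      n * ∑ p ∈ Finset.range T, conductance (G p ω) * diligence (G p ω) := by
  induction T with
  | zero => simp [accumulated]
  | succ T ih =>
    have h : ∀ i ∈ Finset.range n, conductance (G ((T * n + i) / n) ω) *
        diligence (G ((T * n + i) / n) ω) = conductance (G T ω) * diligence (G T ω) := by
      intro i hi
      rw [mul_comm T n, Nat.mul_add_div hn, Nat.div_eq_of_lt (Finset.mem_range.1 hi), add_zero]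
    rw [Finset.sum_range_succ, mul_add, ← ih, accumulated, add_mul, one_mul,
      Finset.sum_range_add, Finset.sum_congr rfl h]
    simp [accumulated]

/-- If some node is uninformed after the accumulated products of conductance and diligence have
reached `L`, then the weighted potential is large. -/
lemma le_weightedPotential (hn : 2 ≤ n) {ω : Outcome n} {T : ℕ} {L : ℝ}
    (hL : L ≤ ∑ p ∈ Finset.range T, conductance (G p ω) * diligence (G p ω)) {v : Fin n}
    (hv : ¬ Informed (fun t => G t ω) v₀ ω (T : ℝ) v) :
    ENNReal.ofReal (1 / (n - 1) * Real.exp (L / 8)) ≤ weightedPotential G v₀ (T * n) ω := by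
  have hn0 : 0 < n := by omega
  have hn' : (2 : ℝ) ≤ n := by exact_mod_cast hn
  have hT : ((T * n : ℕ) : ℝ) / n = T := by
    push_cast
    field_simp
  have hmem : v ∉ informedAt G v₀ (T * n) ω := fun h =>
    hv (hT ▸ informed_of_mem_informedAt hn0 G v₀ ω (T * n) v h)
  have hpos : ∀ j, 1 ≤ (informedAt G v₀ j ω).card := fun j => by
    induction j with
    | zero => simp [informedAt]
    | succ j ih => exact ih.trans (Finset.card_le_card (subset_spread _ _ _ _ _))
  have hcard : (informedAt G v₀ (T * n) ω).card ≤ n - 1 := by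
    have huniv : informedAt G v₀ (T * n) ω ≠ Finset.univ := fun h => by simp [h] at hmem
    have := Finset.card_lt_card (Finset.ssubset_univ_iff.2 huniv)
    rw [Finset.card_univ, Fintype.card_fin] at this
    omega
  have hpot : 1 / ((n : ℝ) - 1) ≤ potential n (informedAt G v₀ (T * n) ω).card := by
    refine le_of_eq_of_le ?_ (potential_anti (hpos _) hcard)
    have : (n : ℝ) - 1 ≠ 0 := by linarith
    rw [potential, Nat.cast_sub (by omega), Nat.cast_one]
    field_simp
    ring
  rw [weightedPotential, weight, ← ENNReal.ofReal_mul (le_trans (by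
    have : 0 < (n : ℝ) - 1 := by linarith
    positivity) hpot), accumulated_mul hn0]
  refine ENNReal.ofReal_le_ofReal (mul_le_mul hpot (Real.exp_le_exp.2 ?_) (Real.exp_pos _).le
    (le_trans (by
      have : 0 < (n : ℝ) - 1 := by linarith
      positivity) hpot))
  rw [mul_comm (8 : ℝ), mul_div_mul_left _ _ (by positivity)]
  gcongr

end Network

/-- The initial potential `n - 1` is at most `n ^ (-c)` times the level that the supermartingale
reaches if the spreading fails. Only `C ≥ 20 * c + 40` is used of the constant. -/
lemma exp_bound_of_constant {n : ℕ} (hn : 2 ≤ n) {c : ℝ} (hc : 1 < c) :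
    ((n : ℝ) - 1) ≤ (n : ℝ) ^ (-c) * (1 / (n - 1) *
      Real.exp (((10 * c + 20) / (1 / 2 - 1 / Real.exp 1) * Real.log n - 3) / 8)) := by
  have hn' : (2 : ℝ) ≤ n := by exact_mod_cast hn
  have hlog : (1 : ℝ) / 2 ≤ Real.log n := by
    have h1 := Real.log_two_gt_d9
    have h2 := Real.log_le_log (by norm_num) hn'
    linarith
  have he : 0 < 1 / 2 - 1 / Real.exp 1 := by
    have := Real.exp_one_gt_d9
    rw [sub_pos]
    exact one_div_lt_one_div_of_lt (by norm_num) (by linarith)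
  have hC : 20 * c + 40 ≤ (10 * c + 20) / (1 / 2 - 1 / Real.exp 1) := by
    rw [le_div_iff₀ he]
    have : 0 < 1 / Real.exp 1 := by positivity
    nlinarith
  have hsq : ((n : ℝ) - 1) * (n - 1) ≤ Real.exp (2 * Real.log n) := by
    rw [two_mul, Real.exp_add, Real.exp_log (by linarith)]
    nlinarith
  have hexp : Real.exp (2 * Real.log n) ≤ (n : ℝ) ^ (-c) *
      Real.exp (((10 * c + 20) / (1 / 2 - 1 / Real.exp 1) * Real.log n - 3) / 8) := by
    rw [Real.rpow_def_of_pos (by linarith), ← Real.exp_add, Real.exp_le_exp]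
    have := mul_le_mul_of_nonneg_right hC (by linarith : 0 ≤ Real.log n)
    nlinarith
  have h := hsq.trans hexp
  have hpos : 0 < (n : ℝ) - 1 := by linarith
  rw [mul_left_comm, one_div_mul_eq_div, le_div_iff₀ hpos]
  exact h

theorem theorem1 (n : ℕ) (v₀ : Fin n) (c : ℝ) (hc : 1 < c)
    (G : ℕ → Outcome n → SimpleGraph (Fin n)) (hG : IsDynamicNetwork G) :
    1 - (n : ℝ) ^ (-c) ≤ (outcomeLaw n).real {ω | ∀ T : ℕ,
      IsLeast {t : ℕ | (10 * c + 20) / (1 / 2 - 1 / Real.exp 1) * Real.log n ≤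
        ∑ p ∈ Finset.range (t + 1), conductance (G p ω) * diligence (G p ω)} T →
      ∀ v, Informed (fun t => G t ω) v₀ ω (T : ℝ) v} := by
  rcases Nat.lt_or_ge n 2 with hn | hn
  · obtain rfl : n = 1 := by have := v₀.pos; omega
    simp
  have hn' : (2 : ℝ) ≤ n := by exact_mod_cast hn
  set L := (10 * c + 20) / (1 / 2 - 1 / Real.exp 1) * Real.log n with hL
  set y : ℝ := 1 / (n - 1) * Real.exp ((L - 3) / 8) with hy
  have hy0 : 0 < y := by
    have : 0 < (n : ℝ) - 1 := by linarith
    positivity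
  set bad : Set (Outcome n) := {ω | ∃ j, ENNReal.ofReal y ≤ weightedPotential G v₀ j ω} with hbad
  have hbadm : MeasurableSet bad := by
    have : bad = ⋃ j, {ω | ENNReal.ofReal y ≤ weightedPotential G v₀ j ω} := by
      ext; simp [hbad]
    rw [this]
    exact MeasurableSet.iUnion fun j => measurableSet_le measurable_const
      ((measurable_past_weightedPotential hG j).mono (past_le n _) le_rfl)
  have hprob : (outcomeLaw n).real bad ≤ (n : ℝ) ^ (-c) := by
    have h1 := measure_exists_le_weightedPotential (v₀ := v₀) (by omega) hG (ENNReal.ofReal y)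
    rw [← hbad, ← ofReal_measureReal, ← ENNReal.ofReal_mul hy0.le,
      ENNReal.ofReal_le_ofReal_iff (by linarith)] at h1
    have h2 := h1.trans (exp_bound_of_constant hn hc)
    rw [← hL, ← hy, mul_comm] at h2
    exact le_of_mul_le_mul_right h2 hy0
  have hsub : badᶜ ⊆ {ω | ∀ T : ℕ, IsLeast {t : ℕ | L ≤
      ∑ p ∈ Finset.range (t + 1), conductance (G p ω) * diligence (G p ω)} T →
      ∀ v, Informed (fun t => G t ω) v₀ ω (T : ℝ) v} := by
    intro ω hω T hT v
    by_contra hv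
    -- The graph exposed at time `T` has had no effect yet, so its term is given away.
    have h1 : L ≤ ∑ p ∈ Finset.range (T + 1), conductance (G p ω) * diligence (G p ω) := hT.1
    rw [Finset.sum_range_succ] at h1
    have h2 := conductance_mul_diligence_le hn (G T ω)
    exact hω ⟨T * n, le_weightedPotential hn (by linarith) hv⟩
  calc 1 - (n : ℝ) ^ (-c) ≤ 1 - (outcomeLaw n).real bad := by linarith
    _ = (outcomeLaw n).real badᶜ := (probReal_compl_eq_one_sub hbadm).symm
    _ ≤ _ := measureReal_mono hsub
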